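/- Let $V=\mathbb{C}^4$ with coordinate ring $\mathbb{C}[V]=\mathbb{C}[x_1,x_2,x_3,x_4]$, and consider the ten quadratic forms $$\begin{array}{ll} \phi_{01}=-2(x_1x_4+x_2x_3), & \phi_{02}=2\sqrt{-1}\,(-x_1x_4+x_2x_3),\\ \phi_{03}=2\sqrt{-1}\,(x_1x_2+x_3x_4), & \phi_{04}=2(-x_1x_2+x_3x_4),\\ \phi_{12}=2(x_1x_3-x_2x_4), & \phi_{13}=-x_1^2-x_2^2+x_3^2+x_4^2,\\ \phi_{14}=\sqrt{-1}\,(x_1^2+x_2^2+x_3^2+x_4^2), & \phi_{23}=\sqrt{-1}\,(-x_1^2+x_2^2-x_3^2+x_4^2),\\ \phi_{24}=x_1^2-x_2^2-x_3^2+x_4^2, & \phi_{34}=2(x_1x_3+x_2x_4). \end{array}$$ Let $\mathcal{R}\subset\mathbb{C}[V][t_0^{\pm1},\dots,t_4^{\pm1}]$ be the $\mathbb{C}$-subalgebra generated by $\phi_{ij}t_it_j$ for $0\le i<j\le 4$ and by $t_k^{-2}$ for $0\le k\le 4$, and let $\operatorname{Spec}\mathcal{R}$ be the affine variety of its maximal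 ideals, with the Zariski topology. Let $\Lambda=\{a\in\mathbb{Z}^5:\ a_0+\dots+a_4 \text{ is even}\}$. All exponents of the $t$-monomials occurring in elements of $\mathcal{R}$ lie in $\Lambda$, so the torus $\mathbb{T}_\Lambda=\operatorname{Hom}(\Lambda,\mathbb{C}^*)$ acts on $\mathcal{R}$ by $\tau\cdot(p\,t^d)=\tau(d)\,p\,t^d$ (for $p\in\mathbb{C}[V]$, $d\in\Lambda$), and hence acts on $\operatorname{Spec}\mathcal{R}$ by $f(\tau z)=(\tau\cdot f)(z)$. Let $\kappa=(2,2,2,2,2)\in\Lambda$, and let $\chi^\kappa(\tau)=\tau(\kappa)$ be the corresponding character of $\mathbb{T}_\Lambda$. A point $z\in\operatorname{Spec}\mathcal{R}$ is called stable with respect to the linearization $\chi^\kappa$ of the trivial line bundle if its isotropy group in $\mathbb{T}_\Lambda$ is finite and there are an integer $m>0$ and $f\in\mathcal{R}$ with $\tau\cdot f=\chi^\kappa(\tau)^m f$ for all $\tau\in\mathbb{T}_\Lambda$, such that $f(z)\ne0$ and all $\mathbb{T}_\Lambda$-orbits contained in $\{f\neq 0\}$ are closed in $\{f\ne0\}$.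 Then the set $(\operatorname{Spec}\mathcal{R})^s$ of stable points with respect to $\chi^\kappa$ is nonsingular: for every stable point $z$, with maximal ideal $\mathfrak{m}_z\subset\mathcal{R}$, the local ring $\mathcal{R}_{\mathfrak{m}_z}$ is a regular local ring. -/

import Mathlib

open scoped BigOperators

noncomputable section

namespace OrderThirtyTwo

/-- The coordinate ring `ℂ[V] = ℂ[x₁, x₂, x₃, x₄]`; the coordinate `x_{k+1}` is `X k`. -/
abbrev CV : Type := MvPolynomial (Fin 4) ℂ

open MvPolynomial in
/-- The quadratic forms `φ_{ij}`, `0 ≤ i < j ≤ 4`, spanning the eigenspaces of the action of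
`Ab(G)` on the quadratic forms on `V` (only the values with `i < j` are used). -/
def phi : Fin 5 → Fin 5 → CV
  | 0, 1 => C (-2) * (X 0 * X 3 + X 1 * X 2)
  | 0, 2 => C (2 * Complex.I) * (-(X 0 * X 3) + X 1 * X 2)
  | 0, 3 => C (2 * Complex.I) * (X 0 * X 1 + X 2 * X 3)
  | 0, 4 => C 2 * (-(X 0 * X 1) + X 2 * X 3)
  | 1, 2 => C 2 * (X 0 * X 2 - X 1 * X 3)
  | 1, 3 => -X 0 ^ 2 - X 1 ^ 2 + X 2 ^ 2 + X 3 ^ 2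
  | 1, 4 => C Complex.I * (X 0 ^ 2 + X 1 ^ 2 + X 2 ^ 2 + X 3 ^ 2)
  | 2, 3 => C Complex.I * (-X 0 ^ 2 + X 1 ^ 2 - X 2 ^ 2 + X 3 ^ 2)
  | 2, 4 => X 0 ^ 2 - X 1 ^ 2 - X 2 ^ 2 + X 3 ^ 2
  | 3, 4 => C 2 * (X 0 * X 2 + X 1 * X 3)
  | _, _ => 0

/-- The lattice `Λ ⊆ ℤ⁵` of integer vectors with even coordinate sum. -/
def Lam : AddSubgroup (Fin 5 → ℤ) where
  carrier := {a | Even (∑ i, a i)}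
  add_mem' := by
    intro a b ha hb
    simp only [Set.mem_ofPred_eq, Pi.add_apply, Finset.sum_add_distrib] at *
    exact ha.add hb
  zero_mem' := by simp
  neg_mem' := by
    intro a ha
    simp only [Set.mem_ofPred_eq, Pi.neg_apply, Finset.sum_neg_distrib] at *
    exact ha.neg

/-- The weight `e_i + e_j`. -/
def wDeg (i j : Fin 5) : Lam :=
  ⟨Pi.single i 1 + Pi.single j 1, by
    change Even (∑ k, (Pi.single i (1 : ℤ) + Pi.single j 1 : Fin 5 → ℤ) k)
    simp [Finset.sum_add_distrib]⟩

/-- The weight `-2 e_k`. -/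
def uDeg (k : Fin 5) : Lam :=
  ⟨Pi.single k (-2), by
    change Even (∑ i, (Pi.single k (-2 : ℤ) : Fin 5 → ℤ) i)
    simp⟩

/-- The weight `κ = (2, 2, 2, 2, 2)`. -/
def kappa : Lam :=
  ⟨fun _ => 2, by
    change Even (∑ _i : Fin 5, (2 : ℤ))
    decide⟩

/-- `ℂ[V] ⊗ ℂ[𝕋_Λ] = ℂ[V][Λ]`, the Laurent polynomials over `ℂ[V]` in `t₀, …, t₄` all of whose
exponents lie in `Λ`; the monomial `p t^d` is `AddMonoidAlgebra.single d p`. -/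
abbrev Laurent : Type := AddMonoidAlgebra CV Lam

/-- The `ℂ`-algebra `𝓡` generated by `φ_{ij} t_i t_j` (`i < j`) and by `t_k⁻²`. -/
def coxRing : Subalgebra ℂ Laurent :=
  Algebra.adjoin ℂ
    ({f | ∃ i j : Fin 5, i < j ∧ f = AddMonoidAlgebra.single (wDeg i j) (phi i j)} ∪
      {f | ∃ k : Fin 5, f = AddMonoidAlgebra.single (uDeg k) 1})

/-- Inside all Laurent polynomials `ℂ[V][t₀^{±1}, …, t₄^{±1}] = ℂ[V] ⊗ ℂ[𝕋_W]`, the ring `𝓡` is the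
subalgebra generated by `φ_{ij} t_i t_j` (`i < j`) and by `t_k⁻²`. -/
theorem coxRing_map_eq :
    coxRing.map (AddMonoidAlgebra.mapDomainAlgHom ℂ CV Lam.subtype) =
      Algebra.adjoin ℂ
        ({f : AddMonoidAlgebra CV (Fin 5 → ℤ) | ∃ i j : Fin 5, i < j ∧
            f = AddMonoidAlgebra.single (Pi.single i 1 + Pi.single j 1) (phi i j)} ∪
          {f | ∃ k : Fin 5, f = AddMonoidAlgebra.single (Pi.single k (-2)) 1}) := by
  rw [coxRing, AlgHom.map_adjoin, Set.image_union]
  congr 2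
  · ext f
    constructor
    · rintro ⟨_, ⟨i, j, h, rfl⟩, rfl⟩
      exact ⟨i, j, h, by simp [wDeg]⟩
    · rintro ⟨i, j, h, rfl⟩
      exact ⟨_, ⟨i, j, h, rfl⟩, by simp [wDeg]⟩
  · ext f
    constructor
    · rintro ⟨_, ⟨k, rfl⟩, rfl⟩
      exact ⟨k, by simp [uDeg]⟩
    · rintro ⟨k, rfl⟩
      exact ⟨_, ⟨k, rfl⟩, by simp [uDeg]⟩

/-- The torus `𝕋_Λ = Hom(Λ, ℂ*)`. -/
def Torus : Type := Multiplicative Lam →* ℂˣ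

instance : CommGroup Torus := MonoidHom.instCommGroup

instance : FunLike Torus (Multiplicative Lam) ℂˣ := MonoidHom.instFunLike

instance : MonoidHomClass Torus (Multiplicative Lam) ℂˣ := MonoidHom.instMonoidHomClass

/-- The value `χ^d(τ) ∈ ℂ` of the character `χ^d`, `d ∈ Λ`, at `τ ∈ 𝕋_Λ`. -/
def charVal (d : Lam) (τ : Torus) : ℂ := (τ (Multiplicative.ofAdd d) : ℂˣ)

theorem charVal_zero (τ : Torus) : charVal 0 τ = 1 := by simp [charVal]

theorem charVal_add (d e : Lam) (τ : Torus) :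
    charVal (d + e) τ = charVal d τ * charVal e τ := by simp [charVal]

theorem charVal_one (d : Lam) : charVal d 1 = 1 := rfl

theorem charVal_mul (d : Lam) (σ τ : Torus) :
    charVal d (σ * τ) = charVal d σ * charVal d τ := rfl

/-- The action of `τ ∈ 𝕋_Λ` on Laurent polynomials, `p t^d ↦ χ^d(τ) p t^d`. -/
def scale (τ : Torus) : Laurent →ₐ[ℂ] Laurent :=
  (AddMonoidAlgebra.lift CV Laurent Lam
    { toFun := fun d =>
        AddMonoidAlgebra.single d.toAdd (MvPolynomial.C (charVal d.toAdd τ))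
      map_one' := by simp [charVal_zero, AddMonoidAlgebra.one_def]
      map_mul' := fun d e => by
        simp [charVal_add, AddMonoidAlgebra.single_mul_single] }).restrictScalars ℂ

theorem scale_single (τ : Torus) (d : Lam) (p : CV) :
    scale τ (AddMonoidAlgebra.single d p) = AddMonoidAlgebra.single d (charVal d τ • p) := by
  simp [scale, MvPolynomial.smul_eq_C_mul, mul_comm]

theorem scale_one : scale 1 = AlgHom.id ℂ Laurent := by
  apply AlgHom.ext
  intro f
  induction f using AddMonoidAlgebra.induction_linear with
  | zero => simp
  | add f g hf hg => rw [map_add, hf, hg, map_add]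
  | single d p => simp [scale_single, charVal_one]

theorem scale_mul (σ τ : Torus) : scale (σ * τ) = (scale σ).comp (scale τ) := by
  apply AlgHom.ext
  intro f
  induction f using AddMonoidAlgebra.induction_linear with
  | zero => simp
  | add f g hf hg => rw [map_add, hf, hg, map_add]
  | single d p => simp [scale_single, charVal_mul, mul_smul]

theorem scale_mem (τ : Torus) {f : Laurent} (hf : f ∈ coxRing) : scale τ f ∈ coxRing := by
  have key : ∀ (d : Lam) (p : CV), AddMonoidAlgebra.single d p ∈ coxRing →
      scale τ (AddMonoidAlgebra.single d p) ∈ coxRing := by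
    intro d p h
    rw [scale_single, ← AddMonoidAlgebra.smul_single]
    exact coxRing.smul_mem h _
  have h : coxRing ≤ coxRing.comap (scale τ) := by
    refine Algebra.adjoin_le ?_
    rintro _ (⟨i, j, hij, rfl⟩ | ⟨k, rfl⟩)
    · exact key _ _ (Algebra.subset_adjoin (Or.inl ⟨i, j, hij, rfl⟩))
    · exact key _ _ (Algebra.subset_adjoin (Or.inr ⟨k, rfl⟩))
  exact h hf

/-- The ring `𝓡` as a type. -/
def CoxRing : Type := coxRing

instance : CommRing CoxRing := inferInstanceAs (CommRing coxRing)

instance : Algebra ℂ CoxRing := inferInstanceAs (Algebra ℂ coxRing)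

/-- The inclusion `𝓡 ⊆ ℂ[V][Λ]`. -/
def incl : CoxRing →ₐ[ℂ] Laurent := coxRing.val

theorem incl_injective : Function.Injective incl := Subtype.val_injective

/-- The action of `τ ∈ 𝕋_Λ` on `𝓡`: a homogeneous element of degree `d` is multiplied by
`χ^d(τ)`. -/
def act (τ : Torus) : CoxRing →ₐ[ℂ] CoxRing :=
  ((scale τ).comp incl).codRestrict coxRing fun f => scale_mem τ f.2

theorem incl_act (τ : Torus) (f : CoxRing) : incl (act τ f) = scale τ (incl f) := rfl

theorem act_one_apply (f : CoxRing) : act 1 f = f :=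
  incl_injective (by rw [incl_act, scale_one]; rfl)

theorem act_mul_apply (σ τ : Torus) (f : CoxRing) : act (σ * τ) f = act σ (act τ f) :=
  incl_injective (by rw [incl_act, scale_mul]; rfl)

theorem act_surjective (τ : Torus) : Function.Surjective (act τ) := fun f =>
  ⟨act τ⁻¹ f, by rw [← act_mul_apply, mul_inv_cancel, act_one_apply]⟩

/-- `Spec 𝓡`, the affine variety of closed points, with the Zariski topology. -/
abbrev SpecR : Type := MaximalSpectrum CoxRing

/-- The action of `𝕋_Λ` on `Spec 𝓡`: `f(τ • z) = (act τ f)(z)`. -/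
instance : MulAction Torus SpecR where
  smul τ z := ⟨z.asIdeal.comap (act τ),
    Ideal.comap_isMaximal_of_surjective (act τ) (act_surjective τ)⟩
  one_smul z := MaximalSpectrum.ext (Ideal.ext fun f => by
    change act 1 f ∈ z.asIdeal ↔ f ∈ z.asIdeal
    rw [act_one_apply])
  mul_smul σ τ z := MaximalSpectrum.ext (Ideal.ext fun f => by
    change act (σ * τ) f ∈ z.asIdeal ↔ act τ (act σ f) ∈ z.asIdeal
    rw [mul_comm, act_mul_apply])

/-- The open set `{z | f(z) ≠ 0}` of `Spec 𝓡`. -/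
def nonvanishing (f : CoxRing) : Set SpecR := {z | f ∉ z.asIdeal}

/-- `f` is a `𝕋_Λ`-invariant section of the `m`-th power of the trivial line bundle on `Spec 𝓡`
linearized by the character `χ^u`, that is `f(τ • z) = χ^u(τ)^m f(z)`. -/
def IsInvariantSection (u : Lam) (m : ℕ) (f : CoxRing) : Prop :=
  ∀ τ : Torus, act τ f = charVal u τ ^ m • f

/-- The point `z` is stable with respect to the linearization given by `χ^u`: its isotropy group is
finite and some invariant section `f` of a positive power of the linearized bundle does not vanish
at `z` and is such that all orbits in `{f ≠ 0}` are closed in `{f ≠ 0}`.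
(The set `{f ≠ 0}` is always affine, because `Spec 𝓡` is.) -/
def IsStable (u : Lam) (z : SpecR) : Prop :=
  Finite (MulAction.stabilizer Torus z) ∧
    ∃ m : ℕ, 0 < m ∧ ∃ f : CoxRing, IsInvariantSection u m f ∧ z ∈ nonvanishing f ∧
      ∀ y ∈ nonvanishing f,
        IsClosed ((↑) ⁻¹' MulAction.orbit Torus y : Set (nonvanishing f))

/-- The stable locus `(Spec 𝓡)^s` of the linearization given by `χ^u`. -/
def stableLocus (u : Lam) : Set SpecR := {z | IsStable u z}

end OrderThirtyTwo

end

/-!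
Up to signs, the generators `wᵢⱼ = φᵢⱼ tᵢ tⱼ` and `uₖ = tₖ⁻²` of `𝓡` satisfy the Plücker relations
together with `∑ⱼ wᵢⱼ wₖⱼ uⱼ = 0` (`isIsotropicPlane`): `w` describes a plane in 5-space which is
totally isotropic for the diagonal quadratic form with coefficients `u`. This reflects the
isomorphism of `Sp₄` with `Spin₅`, under which the quadratic forms on `V = ℂ⁴` become `Λ² ℂ⁵`.

Where `w_ab` is invertible, the Plücker relations and the isotropy of rows `a` and `b` eliminate
all but ten generators, and there remains one equation, the orthogonality of rows `a` and `b`: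
`∑ⱼ w_aj w_bj uⱼ = 0` over the three other indices `j`. Where moreover `w_ac w_bc` or `w_ac u_c` is
invertible for some `c`, this equation can be solved for `u_c` or `w_bc`. So nine generators
suffice after a localization. Since `𝓡` has transcendence degree at least nine (`nine_le_trdeg`),
they are algebraically independent, and the localization of `𝓡` is a localization of a polynomial
ring, hence regular (`IsIsotropicPlane.isRegularLocalRing`).

It remains to see that such indices exist at a stable point `z`; only semistability is needed for
this. An invariant section that does not vanish at `z` has a monomial
`∏ wᵢⱼ ^ aᵢⱼ ∏ uₖ ^ bₖ` of weight `m (2, 2, 2, 2, 2)` that does not vanish at `z`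
(`exists_prod_gen_notMem`). Regard the exponents `aᵢⱼ` as a multigraph on five vertices; vertex `i`
has degree `2m + 2bᵢ`. If some `b_c` is positive and `a` is a neighbour of `c`, then the isotropy
relation `∑ⱼ w_aj² uⱼ = 0` has the nonzero term `w_ac² u_c`, so there is another index `b` with
`w_ab` nonzero. If all `bᵢ` vanish, the multigraph is regular on an odd number of vertices and
therefore not bipartite. By the Plücker relations the pairs `i, j` with `wᵢⱼ(z) ≠ 0` form a complete
multipartite graph, which then contains a triangle (`IsIsotropicPlane.exists_transversal`).
-/

namespace OrderThirtyTwo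

/-! ### Regularity through a polynomial chart -/

/-- The elements of `R` which lie in the subalgebra `A` after multiplication by a power of `g`:
the preimage in `R` of `A[1/g]`. -/
def awayClosure {k R : Type*} [CommRing k] [CommRing R] [Algebra k R] (A : Subalgebra k R) (g : R)
    (hg : g ∈ A) : Subalgebra k R where
  carrier := {r | ∃ n : ℕ, g ^ n * r ∈ A}
  mul_mem' := by
    rintro r s ⟨n, hn⟩ ⟨m, hm⟩
    exact ⟨n + m, by simpa [pow_add, mul_mul_mul_comm] using A.mul_mem hn hm⟩
  add_mem' := by
    rintro r s ⟨n, hn⟩ ⟨m, hm⟩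
    refine ⟨n + m, ?_⟩
    have h := A.add_mem (A.mul_mem (A.pow_mem hg m) hn) (A.mul_mem (A.pow_mem hg n) hm)
    convert h using 1
    ring
  algebraMap_mem' c := ⟨0, by simp⟩

theorem mem_awayClosure {k R : Type*} [CommRing k] [CommRing R] [Algebra k R]
    {A : Subalgebra k R} {g : R} {hg : g ∈ A} {r : R} :
    r ∈ awayClosure A g hg ↔ ∃ n : ℕ, g ^ n * r ∈ A := Iff.rfl

theorem le_awayClosure {k R : Type*} [CommRing k] [CommRing R] [Algebra k R]
    (A : Subalgebra k R) (g : R) (hg : g ∈ A) : A ≤ awayClosure A g hg :=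
  fun r hr => ⟨0, by simpa using hr⟩

/-- Divisors of `g` with cofactor in `A` are invertible on `A[1/g]`. -/
theorem mem_awayClosure_of_mul_mem {k R : Type*} [CommRing k] [CommRing R] [Algebra k R]
    {A : Subalgebra k R} {g : R} {hg : g ∈ A} {h h' : R} (hh : h * h' = g) (hA : h' ∈ A) {r : R}
    (hr : h * r ∈ awayClosure A g hg) : r ∈ awayClosure A g hg := by
  obtain ⟨n, hn⟩ := hr
  refine ⟨n + 1, ?_⟩
  have := A.mul_mem hn hA
  rw [← hh] at this ⊢
  convert this using 1
  ring

/-- If `A[1/g] = R[1/g]` with `A` regular, then `R` is regular at all primes not containing `g`. -/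
theorem isRegularLocalRing_of_awayClosure_eq_top {k R : Type*} [CommRing k] [CommRing R]
    [Algebra k R] (A : Subalgebra k R) [IsRegularRing A] (g : R) (hg : g ∈ A)
    (h : awayClosure A g hg = ⊤) (z : Ideal R) [z.IsPrime] (hz : g ∉ z) :
    IsRegularLocalRing (Localization.AtPrime z) := by
  let q : Ideal A := z.comap (algebraMap A R)
  let Rz := Localization.AtPrime z
  have hfrac : ∀ r : R, ∃ n : ℕ, g ^ n * r ∈ A := fun r => by
    rw [← mem_awayClosure (hg := hg), h]; exact Algebra.mem_top
  have hpow : ∀ n : ℕ, g ^ n ∉ z := fun n hn => hz (Ideal.IsPrime.mem_of_pow_mem ‹_› n hn)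
  have hloc : IsLocalization.AtPrime Rz q := by
    refine (isLocalization_iff _ _).2 ⟨?_, ?_, ?_⟩
    · rintro ⟨a, ha⟩
      rw [IsScalarTower.algebraMap_apply A R Rz]
      exact IsLocalization.map_units Rz (⟨algebraMap A R a, ha⟩ : z.primeCompl)
    · intro y
      obtain ⟨⟨r, s⟩, hrs⟩ := IsLocalization.surj z.primeCompl y
      obtain ⟨n, hn⟩ := hfrac r
      obtain ⟨m, hm⟩ := hfrac s
      refine ⟨(⟨g ^ m * (g ^ n * r), A.mul_mem (A.pow_mem hg m) hn⟩,
        ⟨⟨g ^ n * (g ^ m * s), A.mul_mem (A.pow_mem hg n) hm⟩, ?_⟩), ?_⟩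
      · exact z.primeCompl.mul_mem (hpow n) (z.primeCompl.mul_mem (hpow m) s.2)
      · simp only [IsScalarTower.algebraMap_apply A R Rz]
        change y * algebraMap R Rz (g ^ n * (g ^ m * s)) = algebraMap R Rz (g ^ m * (g ^ n * r))
        simp only [map_mul]
        rw [← hrs]
        ring
    · intro a b hab
      rw [IsScalarTower.algebraMap_apply A R Rz, IsScalarTower.algebraMap_apply A R Rz] at hab
      obtain ⟨s, hs⟩ := IsLocalization.exists_of_eq (M := z.primeCompl) hab
      obtain ⟨m, hm⟩ := hfrac s
      refine ⟨⟨⟨g ^ m * s, hm⟩, z.primeCompl.mul_mem (hpow m) s.2⟩, Subtype.ext ?_⟩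
      change g ^ m * s * (a : R) = g ^ m * s * (b : R)
      rw [mul_assoc, mul_assoc]
      exact congrArg _ hs
  exact IsRegularLocalRing.of_ringEquiv
    (IsLocalization.algEquiv q.primeCompl (Localization.AtPrime q) Rz).toRingEquiv

/-- A ring which becomes generated by as many elements as its transcendence degree after
inverting `g` is, away from `g`, an open part of affine space: those elements are algebraically
independent. -/
theorem isRegularLocalRing_of_chart {k R : Type} [Field k] [CommRing R] [IsDomain R]
    [Algebra k R] {ι : Type} [Finite ι] (x : ι → R) (htr : Cardinal.mk ι ≤ Algebra.trdeg k R)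
    (g : R) (hg : g ∈ Algebra.adjoin k (Set.range x))
    (h : awayClosure (Algebra.adjoin k (Set.range x)) g hg = ⊤) (z : Ideal R) [z.IsPrime]
    (hz : g ∉ z) : IsRegularLocalRing (Localization.AtPrime z) := by
  have hg0 : g ≠ 0 := fun h0 => hz (h0 ▸ z.zero_mem)
  have halg : Algebra.IsAlgebraic (Algebra.adjoin k (Set.range x)) R := by
    constructor
    intro r
    obtain ⟨n, hn⟩ : r ∈ awayClosure (Algebra.adjoin k (Set.range x)) g hg := h ▸ Algebra.mem_top
    let a : Algebra.adjoin k (Set.range x) := ⟨g, hg⟩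
    let b : Algebra.adjoin k (Set.range x) := ⟨g ^ n * r, hn⟩
    refine ⟨Polynomial.C (a ^ n) * Polynomial.X - Polynomial.C b, fun h0 => ?_, ?_⟩
    · have h1 := congrArg (Polynomial.coeff · 1) h0
      simp only [Polynomial.coeff_sub, Polynomial.coeff_C_mul, Polynomial.coeff_X_one, mul_one,
        Polynomial.coeff_C_succ, sub_zero, Polynomial.coeff_zero] at h1
      exact pow_ne_zero n hg0 (congrArg Subtype.val h1)
    · simp [a, b, Algebra.algebraMap_eq_smul_one, Subalgebra.smul_def]
  have hind := (Algebra.IsAlgebraic.isTranscendenceBasis_of_le_trdeg_of_finite k x htr).1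
  have : IsRegularRing (Algebra.adjoin k (Set.range x)) :=
    IsRegularRing.of_ringEquiv hind.aevalEquiv.toRingEquiv
  exact isRegularLocalRing_of_awayClosure_eq_top _ g hg h z hz

/-! ### Isotropic planes for a diagonal quadratic form -/

/-- `w` is an alternating `5 × 5` matrix satisfying the Plücker relations, so that over a field it
is zero or the matrix of Plücker coordinates of a plane in 5-space, spanned by its rows, and the
rows are orthogonal to each other and to themselves for the diagonal quadratic form with
coefficients `u`. -/
structure IsIsotropicPlane {R : Type*} [CommRing R] (w : Fin 5 → Fin 5 → R) (u : Fin 5 → R) :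
    Prop where
  self : ∀ i, w i i = 0
  swap : ∀ i j, w i j = -w j i
  plucker : ∀ i j k l, w i j * w k l - w i k * w j l + w i l * w j k = 0
  isotropic : ∀ i k, ∑ j, w i j * w k j * u j = 0

namespace IsIsotropicPlane

variable {R : Type*} [CommRing R] {w : Fin 5 → Fin 5 → R} {u : Fin 5 → R}

theorem comp_perm (h : IsIsotropicPlane w u) (σ : Equiv.Perm (Fin 5)) :
    IsIsotropicPlane (fun i j => w (σ i) (σ j)) (fun i => u (σ i)) where
  self _ := h.self _
  swap _ _ := h.swap _ _
  plucker _ _ _ _ := h.plucker _ _ _ _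
  isotropic i k :=
    (Equiv.sum_comp σ fun j => w (σ i) j * w (σ k) j * u j).trans (h.isotropic (σ i) (σ k))

theorem swap_notMem (h : IsIsotropicPlane w u) {z : Ideal R} {i j : Fin 5} (hij : w i j ∉ z) :
    w j i ∉ z := by rwa [h.swap, neg_mem_iff]

/-- The first two rows of `w` and the last three coefficients of the form determine the remaining
entries rationally, with only `w₀₁` in the denominators: the Plücker relations give the other
`wᵢⱼ`, and isotropy of the two rows gives `u₀` and `u₁`. -/
theorem mem_of_row_mem {k : Type*} [CommRing k] [Algebra k R] (h : IsIsotropicPlane w u)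
    (L : Subalgebra k R) (hdiv : ∀ r, w 0 1 * r ∈ L → r ∈ L) (h0 : ∀ i, w 0 i ∈ L)
    (h1 : ∀ i, w 1 i ∈ L) (h2 : u 2 ∈ L) (h3 : u 3 ∈ L) (h4 : u 4 ∈ L) :
    (∀ i j, w i j ∈ L) ∧ ∀ i, u i ∈ L := by
  have sq : ∀ p : Fin 5, (∀ i, w p i ∈ L) →
      w p 2 * w p 2 * u 2 + w p 3 * w p 3 * u 3 + w p 4 * w p 4 * u 4 ∈ L := fun p hp =>
    L.add_mem (L.add_mem (L.mul_mem (L.mul_mem (hp _) (hp _)) h2)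
      (L.mul_mem (L.mul_mem (hp _) (hp _)) h3)) (L.mul_mem (L.mul_mem (hp _) (hp _)) h4)
  constructor
  · intro i j
    refine hdiv _ ?_
    have e : w 0 1 * w i j = w 0 i * w 1 j - w 0 j * w 1 i := by
      linear_combination h.plucker 0 1 i j
    rw [e]
    exact L.sub_mem (L.mul_mem (h0 _) (h1 _)) (L.mul_mem (h0 _) (h1 _))
  · have hu0 : u 0 ∈ L := by
      refine hdiv _ (hdiv _ ?_)
      have e := h.isotropic 1 1
      rw [Fin.sum_univ_five, h.self 1, h.swap 1 0] at e
      have e' : w 0 1 * (w 0 1 * u 0) =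
          -(w 1 2 * w 1 2 * u 2 + w 1 3 * w 1 3 * u 3 + w 1 4 * w 1 4 * u 4) := by
        linear_combination e
      rw [e']
      exact L.neg_mem (sq 1 h1)
    have hu1 : u 1 ∈ L := by
      refine hdiv _ (hdiv _ ?_)
      have e := h.isotropic 0 0
      rw [Fin.sum_univ_five, h.self 0] at e
      have e' : w 0 1 * (w 0 1 * u 1) =
          -(w 0 2 * w 0 2 * u 2 + w 0 3 * w 0 3 * u 3 + w 0 4 * w 0 4 * u 4) := by
        linear_combination e
      rw [e']
      exact L.neg_mem (sq 0 h0)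
    intro i
    fin_cases i <;> assumption

/-- Orthogonality of the first two rows: the only isotropy relation not used to eliminate `u₀` and
`u₁`. -/
theorem isotropic_zero_one (h : IsIsotropicPlane w u) :
    w 0 2 * w 1 2 * u 2 = -(w 0 3 * w 1 3 * u 3 + w 0 4 * w 1 4 * u 4) := by
  have e := h.isotropic 0 1
  rw [Fin.sum_univ_five, h.self 0, h.self 1] at e
  linear_combination e

/-- Where `w₀₁`, `w₀₂`, `w₁₂` are invertible, `u₂` can be eliminated from the orthogonality of the
first two rows, which leaves nine coordinates. -/
theorem awayClosure_triangle {k : Type*} [CommRing k] [Algebra k R] (h : IsIsotropicPlane w u)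
    (A : Subalgebra k R) (h01 : w 0 1 ∈ A) (h02 : w 0 2 ∈ A) (h12 : w 1 2 ∈ A) (h03 : w 0 3 ∈ A)
    (h13 : w 1 3 ∈ A) (h04 : w 0 4 ∈ A) (h14 : w 1 4 ∈ A) (h3 : u 3 ∈ A) (h4 : u 4 ∈ A)
    (hg : w 0 1 * w 0 2 * w 1 2 ∈ A) :
    (∀ i j, w i j ∈ awayClosure A _ hg) ∧ ∀ i, u i ∈ awayClosure A _ hg := by
  have hle := le_awayClosure A _ hg
  refine h.mem_of_row_mem _ (fun r => mem_awayClosure_of_mul_mem (h' := w 0 2 * w 1 2) (by ring)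
    (A.mul_mem h02 h12)) (fun i => hle ?_) (fun i => hle ?_) ?_ (hle h3) (hle h4)
  · fin_cases i
    · simp [h.self]
    all_goals assumption
  · fin_cases i
    · change w 1 0 ∈ A
      rw [h.swap]
      exact A.neg_mem h01
    · simp [h.self]
    all_goals assumption
  · refine mem_awayClosure_of_mul_mem (h := w 0 2 * w 1 2) (h' := w 0 1) (by ring) h01 (hle ?_)
    rw [h.isotropic_zero_one]
    exact A.neg_mem (A.add_mem (A.mul_mem (A.mul_mem h03 h13) h3)
      (A.mul_mem (A.mul_mem h04 h14) h4))

/-- Where `w₀₁`, `w₀₂`, `u₂` are invertible, `w₁₂` can be eliminated from the orthogonality of the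
first two rows, which leaves nine coordinates. -/
theorem awayClosure_path {k : Type*} [CommRing k] [Algebra k R] (h : IsIsotropicPlane w u)
    (A : Subalgebra k R) (h01 : w 0 1 ∈ A) (h02 : w 0 2 ∈ A) (h2 : u 2 ∈ A) (h03 : w 0 3 ∈ A)
    (h13 : w 1 3 ∈ A) (h04 : w 0 4 ∈ A) (h14 : w 1 4 ∈ A) (h3 : u 3 ∈ A) (h4 : u 4 ∈ A)
    (hg : w 0 1 * w 0 2 * u 2 ∈ A) :
    (∀ i j, w i j ∈ awayClosure A _ hg) ∧ ∀ i, u i ∈ awayClosure A _ hg := by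
  have hle := le_awayClosure A _ hg
  have h12 : w 1 2 ∈ awayClosure A _ hg := by
    refine mem_awayClosure_of_mul_mem (h := w 0 2 * u 2) (h' := w 0 1) (by ring) h01 (hle ?_)
    have e : w 0 2 * u 2 * w 1 2 = -(w 0 3 * w 1 3 * u 3 + w 0 4 * w 1 4 * u 4) := by
      rw [← h.isotropic_zero_one]
      ring
    rw [e]
    exact A.neg_mem (A.add_mem (A.mul_mem (A.mul_mem h03 h13) h3)
      (A.mul_mem (A.mul_mem h04 h14) h4))
  refine h.mem_of_row_mem _ (fun r => mem_awayClosure_of_mul_mem (h' := w 0 2 * u 2) (by ring)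
    (A.mul_mem h02 h2)) (fun i => hle ?_) (fun i => ?_) (hle h2) (hle h3) (hle h4)
  · fin_cases i
    · simp [h.self]
    all_goals assumption
  · fin_cases i
    · change w 1 0 ∈ awayClosure A _ hg
      exact hle (h.swap 1 0 ▸ A.neg_mem h01)
    · simp [h.self]
    · exact h12
    · exact hle h13
    · exact hle h14

end IsIsotropicPlane

theorem exists_perm_apply_eq {a b c : Fin 5} (hab : a ≠ b) (hac : a ≠ c) (hbc : b ≠ c) :
    ∃ σ : Equiv.Perm (Fin 5), σ 0 = a ∧ σ 1 = b ∧ σ 2 = c := by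
  refine ⟨Equiv.swap (Equiv.swap (Equiv.swap 0 a 1) b (Equiv.swap 0 a 2)) c *
    Equiv.swap (Equiv.swap 0 a 1) b * Equiv.swap 0 a, ?_⟩
  revert a b c
  decide

/-- A domain of transcendence degree at least `9` generated by the Plücker coordinates of an
isotropic plane and the coefficients of the form is regular at the primes where some orthogonality
relation of two rows can be solved for one of its variables: there the nine remaining generators
are coordinates of a chart. -/
theorem IsIsotropicPlane.isRegularLocalRing {k R : Type} [Field k] [CommRing R] [IsDomain R]
    [Algebra k R] {w : Fin 5 → Fin 5 → R} {u : Fin 5 → R} (h : IsIsotropicPlane w u)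
    (hgen : ∀ S : Subalgebra k R, (∀ i j, w i j ∈ S) → (∀ i, u i ∈ S) → S = ⊤)
    (htr : 9 ≤ Algebra.trdeg k R) (z : Ideal R) [hz : z.IsPrime] {a b c : Fin 5} (hbc : b ≠ c)
    (hab : w a b ∉ z) (hac : w a c ∉ z) (hc : w b c ∉ z ∨ u c ∉ z) :
    IsRegularLocalRing (Localization.AtPrime z) := by
  have hne : ∀ {i j}, w i j ∉ z → i ≠ j := by
    rintro i j hij rfl
    exact hij (h.self i ▸ z.zero_mem)
  obtain ⟨σ, rfl, rfl, rfl⟩ := exists_perm_apply_eq (hne hab) (hne hac) hbc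
  have hσ := h.comp_perm σ
  have key : ∀ S : Subalgebra k R,
      ((∀ i j, w (σ i) (σ j) ∈ S) ∧ ∀ i, u (σ i) ∈ S) → S = ⊤ := fun S hS =>
    hgen S (fun i j => by simpa using hS.1 (σ.symm i) (σ.symm j))
      (fun i => by simpa using hS.2 (σ.symm i))
  have hmul : ∀ {x y : R}, x ∉ z → y ∉ z → x * y ∉ z := fun hx hy hxy =>
    (hz.mem_or_mem hxy).elim hx hy
  rcases hc with hc | hc
  · let x : Fin 9 → R := ![w (σ 0) (σ 1), w (σ 0) (σ 2), w (σ 1) (σ 2), w (σ 0) (σ 3),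
      w (σ 1) (σ 3), w (σ 0) (σ 4), w (σ 1) (σ 4), u (σ 3), u (σ 4)]
    let A := Algebra.adjoin k (Set.range x)
    have hx : ∀ i, x i ∈ A := fun i => Algebra.subset_adjoin ⟨i, rfl⟩
    have hg := A.mul_mem (A.mul_mem (hx 0) (hx 1)) (hx 2)
    exact isRegularLocalRing_of_chart x (by simpa using htr) _ hg
      (key _ (hσ.awayClosure_triangle A (hx 0) (hx 1) (hx 2) (hx 3) (hx 4) (hx 5) (hx 6) (hx 7)
        (hx 8) hg)) z (hmul (hmul hab hac) hc)
  · let x : Fin 9 → R := ![w (σ 0) (σ 1), w (σ 0) (σ 2), u (σ 2), w (σ 0) (σ 3),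
      w (σ 1) (σ 3), w (σ 0) (σ 4), w (σ 1) (σ 4), u (σ 3), u (σ 4)]
    let A := Algebra.adjoin k (Set.range x)
    have hx : ∀ i, x i ∈ A := fun i => Algebra.subset_adjoin ⟨i, rfl⟩
    have hg := A.mul_mem (A.mul_mem (hx 0) (hx 1)) (hx 2)
    exact isRegularLocalRing_of_chart x (by simpa using htr) _ hg
      (key _ (hσ.awayClosure_path A (hx 0) (hx 1) (hx 2) (hx 3) (hx 4) (hx 5) (hx 6) (hx 7)
        (hx 8) hg)) z (hmul (hmul hab hac) hc)

/-! ### Semistability -/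

/-- The numerical part of semistability: `a` is the adjacency matrix of a multigraph whose edges
are coordinates of the plane outside `z`. The degree conditions express that the monomial
`∏ wᵢⱼ ^ aᵢⱼ ∏ uₖ ^ bₖ` has weight a positive multiple of `(2, 2, 2, 2, 2)`.

If some `bₖ` is positive, isotropy gives a second edge at a neighbour of `k`. Otherwise the
multigraph is regular on an odd number of vertices, hence not bipartite; but without triangles the
Plücker relations would make it complete bipartite. -/
theorem IsIsotropicPlane.exists_transversal {R : Type*} [CommRing R] {w : Fin 5 → Fin 5 → R}
    {u : Fin 5 → R} (h : IsIsotropicPlane w u) (z : Ideal R) [hz : z.IsPrime]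
    (a : Fin 5 → Fin 5 → ℕ) (b : Fin 5 → ℕ) {m : ℕ} (hm : 0 < m) (hsymm : ∀ i j, a i j = a j i)
    (hdeg : ∀ i, ∑ j, a i j = 2 * m + 2 * b i) (ha : ∀ i j, a i j ≠ 0 → w i j ∉ z)
    (hb : ∀ k, b k ≠ 0 → u k ∉ z) :
    ∃ i j k, j ≠ k ∧ w i j ∉ z ∧ w i k ∉ z ∧ (w j k ∉ z ∨ u k ∉ z) := by
  have hnbr : ∀ i, ∃ j, w i j ∉ z := by
    intro i
    have hpos : ∑ j, a i j ≠ 0 := by rw [hdeg]; omega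
    obtain ⟨j, _, hj⟩ := Finset.exists_ne_zero_of_sum_ne_zero hpos
    exact ⟨j, ha i j hj⟩
  by_cases hb0 : ∃ k, b k ≠ 0
  · obtain ⟨k, hk⟩ := hb0
    obtain ⟨i, hi⟩ := hnbr k
    have hik := h.swap_notMem hi
    have huk := hb k hk
    by_contra hcon
    have hzero : ∀ j, j ≠ k → w i j ∈ z := fun j hj => by
      by_contra hij
      exact hcon ⟨i, j, k, hj, hij, hik, Or.inr huk⟩
    have hsum := h.isotropic i i
    rw [← Finset.add_sum_erase _ _ (Finset.mem_univ k)] at hsum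
    have hrest : ∑ j ∈ Finset.univ.erase k, w i j * w i j * u j ∈ z :=
      z.sum_mem fun j hj =>
        z.mul_mem_right _ (z.mul_mem_right _ (hzero j (Finset.ne_of_mem_erase hj)))
    have : w i k * w i k * u k ∈ z := by
      rw [eq_neg_of_add_eq_zero_left hsum]
      exact neg_mem hrest
    rcases hz.mem_or_mem this with h1 | h1
    · exact (hz.mem_or_mem h1).elim hik hik
    · exact huk h1
  · push Not at hb0
    by_contra hcon
    have hno : ∀ i j k, w i j ∉ z → w i k ∉ z → w j k ∈ z := by
      intro i j k hij hik
      by_cases hjk : j = k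
      · rw [hjk, h.self]
        exact z.zero_mem
      · by_contra hw
        exact hcon ⟨i, j, k, hjk, hij, hik, Or.inl hw⟩
    -- Non-adjacency is transitive: two coordinate functions of the plane proportional to a third,
    -- nonzero one are proportional.
    have htrans : ∀ i j k, w i j ∈ z → w j k ∈ z → w i k ∈ z := by
      intro i j k hij hjk
      obtain ⟨l, hl⟩ := hnbr j
      have e : w i k * w j l = w i j * w k l + w i l * w j k := by
        linear_combination -h.plucker i j k l
      have : w i k * w j l ∈ z := by
        rw [e]
        exact z.add_mem (z.mul_mem_right _ hij) (z.mul_mem_left _ hjk)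
      exact (hz.mem_or_mem this).resolve_right hl
    classical
    let N : Finset (Fin 5) := Finset.univ.filter fun j => w 0 j ∉ z
    have ha0 : ∀ i j, w i j ∈ z → a i j = 0 := fun i j hij => by
      by_contra h0
      exact ha i j h0 hij
    have hN : ∀ i ∈ N, ∀ j ∈ N, a i j = 0 := fun i hi j hj =>
      ha0 i j (hno 0 i j (Finset.mem_filter.1 hi).2 (Finset.mem_filter.1 hj).2)
    have hNc : ∀ i ∈ Nᶜ, ∀ j ∈ Nᶜ, a i j = 0 := by
      intro i hi j hj
      simp only [N, Finset.mem_compl, Finset.mem_filter, Finset.mem_univ, true_and, not_not]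
        at hi hj
      refine ha0 i j (htrans i 0 j ?_ hj)
      rw [h.swap]
      exact neg_mem hi
    have hs : ∀ i, ∑ j ∈ N, a i j + ∑ j ∈ Nᶜ, a i j = 2 * m := fun i => by
      rw [Finset.sum_add_sum_compl, hdeg, hb0, mul_zero, add_zero]
    have h1 : ∑ i ∈ N, ∑ j ∈ Nᶜ, a i j = N.card * (2 * m) := by
      rw [← smul_eq_mul, ← Finset.sum_const]
      refine Finset.sum_congr rfl fun i hi => ?_
      rw [← hs i, Finset.sum_eq_zero (hN i hi), zero_add]
    have h2 : ∑ j ∈ Nᶜ, ∑ i ∈ N, a j i = Nᶜ.card * (2 * m) := by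
      rw [← smul_eq_mul, ← Finset.sum_const]
      refine Finset.sum_congr rfl fun i hi => ?_
      rw [← hs i, Finset.sum_eq_zero (hNc i hi), add_zero]
    rw [Finset.sum_comm] at h1
    have h3 : N.card = Nᶜ.card := by
      refine Nat.eq_of_mul_eq_mul_right (show 0 < 2 * m by omega) ?_
      rw [← h1, ← h2]
      exact Finset.sum_congr rfl fun j _ => Finset.sum_congr rfl fun i _ => by rw [hsymm]
    have h4 := Finset.card_add_card_compl N
    rw [Fintype.card_fin] at h4
    omega

/-! ### The relations between the generators of `𝓡` -/

/-- The forms `φ_{ij}` arranged in an alternating matrix, with the signs of `φ₀₁`, `φ₀₂`, `φ₁₄`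
changed. With these signs the rows span an isotropic plane of the standard quadratic form on
5-space. -/
noncomputable def altPhi : Fin 5 → Fin 5 → CV :=
  ![![0, -phi 0 1, -phi 0 2, phi 0 3, phi 0 4],
    ![phi 0 1, 0, phi 1 2, phi 1 3, -phi 1 4],
    ![phi 0 2, -phi 1 2, 0, phi 2 3, phi 2 4],
    ![-phi 0 3, -phi 1 3, -phi 2 3, 0, phi 3 4],
    ![-phi 0 4, phi 1 4, -phi 2 4, -phi 3 4, 0]]

theorem altPhi_self (i : Fin 5) : altPhi i i = 0 := by
  fin_cases i <;> simp [altPhi]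

theorem altPhi_swap (i j : Fin 5) : altPhi i j = -altPhi j i := by
  fin_cases i <;> fin_cases j <;> simp [altPhi]

theorem altPhi_eq_or {i j : Fin 5} (h : i < j) :
    altPhi i j = phi i j ∨ altPhi i j = -phi i j := by
  fin_cases i <;> fin_cases j <;> simp [altPhi] at h ⊢

theorem C_I_sq : (MvPolynomial.C Complex.I : CV) ^ 2 = -1 := by
  rw [← map_pow, Complex.I_sq, map_neg, map_one]

open MvPolynomial in
theorem altPhi_zero_three_mul (i j : Fin 5) :
    altPhi 0 3 * altPhi i j = altPhi 0 i * altPhi 3 j - altPhi 0 j * altPhi 3 i := by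
  have h := C_I_sq
  have h2 : (C 2 : CV) = 2 := map_ofNat C 2
  fin_cases i <;> fin_cases j <;> simp [altPhi, phi] <;> simp only [h2] <;> grind

theorem altPhi_zero_three_ne_zero : altPhi 0 3 ≠ 0 := by
  intro h
  have := congrArg (MvPolynomial.eval fun _ => (1 : ℂ)) h
  simp [altPhi, phi] at this

/-- The matrix has rank two because all its rows are combinations of rows `0` and `3`
(`altPhi_zero_three_mul`). -/
theorem altPhi_plucker (i j k l : Fin 5) :
    altPhi i j * altPhi k l - altPhi i k * altPhi j l + altPhi i l * altPhi j k = 0 := by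
  have h := altPhi_zero_three_mul
  refine (mul_eq_zero.1 ?_).resolve_left (pow_ne_zero 2 altPhi_zero_three_ne_zero)
  calc _ = altPhi 0 3 * altPhi i j * (altPhi 0 3 * altPhi k l)
        - altPhi 0 3 * altPhi i k * (altPhi 0 3 * altPhi j l)
        + altPhi 0 3 * altPhi i l * (altPhi 0 3 * altPhi j k) := by ring
    _ = 0 := by
      rw [h i j, h k l, h i k, h j l, h i l, h j k]
      ring

open MvPolynomial in
theorem sum_altPhi_mul_altPhi (i k : Fin 5) : ∑ j, altPhi i j * altPhi k j = 0 := by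
  have h := C_I_sq
  have h2 : (C 2 : CV) = 2 := map_ofNat C 2
  rw [Fin.sum_univ_five]
  fin_cases i <;> fin_cases k <;> simp [altPhi, phi] <;> simp only [h2] <;> grind

theorem wDeg_comm (i j : Fin 5) : wDeg i j = wDeg j i :=
  Subtype.ext (add_comm (G := Fin 5 → ℤ) _ _)

theorem single_altPhi_mem (i j : Fin 5) :
    (AddMonoidAlgebra.single (wDeg i j) (altPhi i j) : Laurent) ∈ coxRing := by
  have key : ∀ {i j : Fin 5}, i < j →
      (AddMonoidAlgebra.single (wDeg i j) (altPhi i j) : Laurent) ∈ coxRing := by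
    intro i j hij
    have hm : (AddMonoidAlgebra.single (wDeg i j) (phi i j) : Laurent) ∈ coxRing :=
      Algebra.subset_adjoin (Or.inl ⟨i, j, hij, rfl⟩)
    rcases altPhi_eq_or hij with h | h
    · rwa [h]
    · rw [h, AddMonoidAlgebra.single_neg]
      exact coxRing.neg_mem hm
  rcases lt_trichotomy i j with h | rfl | h
  · exact key h
  · rw [altPhi_self, AddMonoidAlgebra.single_zero]
    exact coxRing.zero_mem
  · rw [altPhi_swap, wDeg_comm, AddMonoidAlgebra.single_neg]
    exact coxRing.neg_mem (key h)

/-- The element `±φ_{ij} t_i t_j` of `𝓡`, alternating in `i` and `j`, with the signs of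
`altPhi`. -/
noncomputable def wGen (i j : Fin 5) : CoxRing :=
  ⟨AddMonoidAlgebra.single (wDeg i j) (altPhi i j), single_altPhi_mem i j⟩

/-- The element `t_k⁻²` of `𝓡`. -/
noncomputable def uGen (k : Fin 5) : CoxRing :=
  ⟨AddMonoidAlgebra.single (uDeg k) 1, Algebra.subset_adjoin (Or.inr ⟨k, rfl⟩)⟩

theorem incl_wGen (i j : Fin 5) :
    incl (wGen i j) = AddMonoidAlgebra.single (wDeg i j) (altPhi i j) := rfl

theorem incl_uGen (k : Fin 5) : incl (uGen k) = AddMonoidAlgebra.single (uDeg k) 1 := rfl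

theorem uDeg_eq_neg (k : Fin 5) : uDeg k = -wDeg k k := by
  apply Subtype.ext
  change (Pi.single k (-2) : Fin 5 → ℤ) = -(Pi.single k 1 + Pi.single k 1)
  rw [← Pi.single_add, ← Pi.single_neg]
  rfl

theorem wDeg_add_wDeg_add_uDeg (i j k : Fin 5) : wDeg i j + wDeg k j + uDeg j = wDeg i k := by
  have h : wDeg i j + wDeg k j = wDeg i k + wDeg j j :=
    Subtype.ext (add_add_add_comm (G := Fin 5 → ℤ) _ _ _ _)
  rw [uDeg_eq_neg, h, add_neg_cancel_right]

theorem isIsotropicPlane : IsIsotropicPlane wGen uGen where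
  self i := incl_injective (by
    rw [incl_wGen, altPhi_self, AddMonoidAlgebra.single_zero, map_zero])
  swap i j := incl_injective (by
    rw [map_neg, incl_wGen, incl_wGen, altPhi_swap, wDeg_comm, AddMonoidAlgebra.single_neg])
  plucker i j k l := incl_injective (by
    have h1 : wDeg i k + wDeg j l = wDeg i j + wDeg k l := Subtype.ext (add_add_add_comm _ _ _ _)
    have h2 : wDeg i l + wDeg j k = wDeg i j + wDeg k l := by
      rw [wDeg_comm k l]
      exact Subtype.ext (add_add_add_comm _ _ _ _)
    simp only [map_add, map_sub, map_mul, map_zero, incl_wGen, AddMonoidAlgebra.single_mul_single,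
      h1, h2, ← AddMonoidAlgebra.single_sub, ← AddMonoidAlgebra.single_add, altPhi_plucker,
      AddMonoidAlgebra.single_zero])
  isotropic i k := incl_injective (by
    simp only [map_sum, map_mul, map_zero, incl_wGen, incl_uGen,
      AddMonoidAlgebra.single_mul_single, wDeg_add_wDeg_add_uDeg, mul_one]
    refine (map_sum (AddMonoidAlgebra.singleAddHom (wDeg i k)) _ _).symm.trans ?_
    rw [sum_altPhi_mul_altPhi, map_zero])

theorem eq_top_of_gen_mem (S : Subalgebra ℂ CoxRing) (hw : ∀ i j, wGen i j ∈ S)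
    (hu : ∀ k, uGen k ∈ S) : S = ⊤ := by
  have hle : coxRing ≤ S.map incl := by
    refine Algebra.adjoin_le ?_
    rintro _ (⟨i, j, hij, rfl⟩ | ⟨k, rfl⟩)
    · have h := Subalgebra.mem_map.2 ⟨_, hw i j, incl_wGen i j⟩
      rcases altPhi_eq_or hij with e | e
      · rwa [e] at h
      · rw [e, AddMonoidAlgebra.single_neg] at h
        exact neg_mem_iff.1 h
    · exact ⟨_, hu k, rfl⟩
  refine eq_top_iff.2 fun r _ => ?_
  obtain ⟨s, hs, hsr⟩ := hle r.2
  exact incl_injective hsr ▸ hs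

/-! ### The transcendence degree of `𝓡` -/

instance : UniqueSums Lam :=
  UniqueSums.of_injective_addHom (AddHomClass.toAddHom Lam.subtype) Subtype.val_injective
    inferInstance

instance : IsDomain CoxRing := incl_injective.isDomain incl

noncomputable instance : Algebra CoxRing Laurent := incl.toRingHom.toAlgebra

instance : IsScalarTower ℂ CoxRing Laurent :=
  IsScalarTower.of_algebraMap_eq fun c => (incl.commutes c).symm

instance : FaithfulSMul CoxRing Laurent :=
  (faithfulSMul_iff_algebraMap_injective _ _).2 incl_injective

/-- The nine elements `t_k⁻²` and `x_i` of the Laurent polynomial ring. -/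
noncomputable def laurentCoord : Fin 5 ⊕ Fin 4 → Laurent :=
  Sum.elim (fun k => AddMonoidAlgebra.single (uDeg k) 1)
    fun i => AddMonoidAlgebra.single 0 (MvPolynomial.X i)

/-- The inclusion of the exponent monoid of `ℂ[t₀⁻², …, t₄⁻²]` into `Λ`. -/
noncomputable def uExponent : (Fin 5 →₀ ℕ) →+ Lam :=
  Finsupp.liftAddHom fun k => (multiplesHom Lam (uDeg k))

theorem uExponent_apply (s : Fin 5 →₀ ℕ) (k : Fin 5) : (uExponent s : Fin 5 → ℤ) k = -2 * s k := by
  induction s using Finsupp.induction_linear with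
  | zero => simp
  | add s t hs ht =>
    rw [map_add, AddSubgroup.coe_add, Pi.add_apply, hs, ht]
    push_cast [Finsupp.add_apply]
    ring
  | single j n =>
    simp only [uExponent, Finsupp.liftAddHom_apply_single, multiplesHom_apply]
    rw [AddSubgroup.coe_nsmul]
    change n • (Pi.single j (-2) : Fin 5 → ℤ) k = _
    by_cases h : j = k
    · subst h
      simp [mul_comm]
    · simp [Finsupp.single_eq_of_ne' h, Pi.single_eq_of_ne' h]

theorem uExponent_injective : Function.Injective uExponent := fun s t h => by
  ext k
  have := congrArg (fun d : Lam => (d : Fin 5 → ℤ) k) h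
  simp only [uExponent_apply] at this
  omega

theorem algebraicIndependent_laurentCoord : AlgebraicIndependent ℂ laurentCoord := by
  let f : MvPolynomial (Fin 5) CV →ₐ[ℂ] Laurent :=
    AddMonoidAlgebra.mapDomainAlgHom ℂ CV uExponent
  have hf : Function.Injective f := AddMonoidAlgebra.mapDomain_injective uExponent_injective
  have e : MvPolynomial.aeval laurentCoord =
      f.comp (MvPolynomial.sumAlgEquiv ℂ (Fin 5) (Fin 4)).toAlgHom := by
    apply MvPolynomial.algHom_ext
    rintro (k | i)
    · have : f (MvPolynomial.X k) = AddMonoidAlgebra.single (uExponent (Finsupp.single k 1)) 1 :=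
        AddMonoidAlgebra.mapDomain_single
      simp [laurentCoord, MvPolynomial.sumAlgEquiv_X_inl, this, uExponent]
    · have : f (MvPolynomial.C (MvPolynomial.X i)) =
          AddMonoidAlgebra.single (uExponent 0) (MvPolynomial.X i) :=
        AddMonoidAlgebra.mapDomain_single
      simp [laurentCoord, MvPolynomial.sumAlgEquiv_X_inr, this]
  rw [AlgebraicIndependent, e]
  exact hf.comp (MvPolynomial.sumAlgEquiv ℂ (Fin 5) (Fin 4)).injective

theorem isAlgebraic_single_altPhi (i j : Fin 5) :
    IsAlgebraic CoxRing (AddMonoidAlgebra.single 0 (altPhi i j) : Laurent) := by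
  -- `φ² = (φ tᵢtⱼ)² tᵢ⁻² tⱼ⁻²` lies in `𝓡`.
  refine IsAlgebraic.of_pow two_pos ?_
  have hdeg : wDeg i j + wDeg i j + uDeg i + uDeg j = 0 := by
    rw [add_right_comm, wDeg_add_wDeg_add_uDeg, uDeg_eq_neg, add_neg_cancel]
  have : (AddMonoidAlgebra.single 0 (altPhi i j) : Laurent) ^ 2 =
      algebraMap CoxRing Laurent (wGen i j * wGen i j * uGen i * uGen j) := by
    change _ = incl _
    simp only [map_mul, incl_wGen, incl_uGen, AddMonoidAlgebra.single_mul_single, hdeg, mul_one]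
    rw [AddMonoidAlgebra.single_pow, nsmul_zero, sq]
  rw [this]
  exact isAlgebraic_algebraMap _

open MvPolynomial in
theorem isAlgebraic_single_X (i : Fin 4) :
    IsAlgebraic CoxRing (AddMonoidAlgebra.single 0 (X i) : Laurent) := by
  let T : Subalgebra ℂ CV :=
    ((Subalgebra.algebraicClosure CoxRing Laurent).restrictScalars ℂ).comap
      (IsScalarTower.toAlgHom ℂ CV Laurent)
  have hT : ∀ {p : CV}, p ∈ T ↔ IsAlgebraic CoxRing (AddMonoidAlgebra.single 0 p : Laurent) :=
    Iff.rfl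
  have hp : ∀ i j, altPhi i j ∈ T := fun i j => hT.2 (isAlgebraic_single_altPhi i j)
  have hC : ∀ c : ℂ, C c ∈ T := fun c => T.algebraMap_mem c
  -- The squares of the coordinates are combinations of the four diagonal forms.
  let a := altPhi 1 3
  let b := C Complex.I * altPhi 1 4
  let c := C Complex.I * altPhi 2 3
  let d := altPhi 2 4
  have ha : a ∈ T := hp _ _
  have hb : b ∈ T := T.mul_mem (hC _) (hp _ _)
  have hc : c ∈ T := T.mul_mem (hC _) (hp _ _)
  have hd : d ∈ T := hp _ _
  have hI := C_I_sq
  have h4 : (C (1 / 4) : CV) * 4 = 1 := by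
    rw [← map_ofNat C 4, ← C_mul]
    norm_num
  have hsq : (X i : CV) ^ 2 = C (1 / 4) * (b - a + c + d) ∨
      (X i : CV) ^ 2 = C (1 / 4) * (b - a - c - d) ∨
      (X i : CV) ^ 2 = C (1 / 4) * (b + a + c - d) ∨
      (X i : CV) ^ 2 = C (1 / 4) * (b + a - c + d) := by
    simp only [a, b, c, d]
    fin_cases i
    · left; simp [altPhi, phi]; grind
    · right; left; simp [altPhi, phi]; grind
    · right; right; left; simp [altPhi, phi]; grind
    · right; right; right; simp [altPhi, phi]; grind
  have hX : (X i : CV) ^ 2 ∈ T := by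
    rcases hsq with h | h | h | h <;> rw [h] <;> refine T.mul_mem (hC _) ?_
    · exact T.add_mem (T.add_mem (T.sub_mem hb ha) hc) hd
    · exact T.sub_mem (T.sub_mem (T.sub_mem hb ha) hc) hd
    · exact T.sub_mem (T.add_mem (T.add_mem hb ha) hc) hd
    · exact T.add_mem (T.sub_mem (T.add_mem hb ha) hc) hd
  refine IsAlgebraic.of_pow two_pos ?_
  rw [AddMonoidAlgebra.single_pow, nsmul_zero]
  exact hT.1 hX

theorem nine_le_trdeg : 9 ≤ Algebra.trdeg ℂ CoxRing := by
  let K := Subalgebra.algebraicClosure CoxRing Laurent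
  have hmem : ∀ i, laurentCoord i ∈ K := by
    rintro (k | i)
    · exact isAlgebraic_algebraMap (uGen k)
    · exact isAlgebraic_single_X i
  have hind : AlgebraicIndependent ℂ fun i => (⟨laurentCoord i, hmem i⟩ : K) :=
    
    AlgebraicIndependent.of_comp (IsScalarTower.toAlgHom ℂ K Laurent)
      algebraicIndependent_laurentCoord
  have : FaithfulSMul CoxRing K := (faithfulSMul_iff_algebraMap_injective _ _).2
    fun _ _ h => incl_injective (congrArg (fun r : K => (r : Laurent)) h)
  have h : Algebra.trdeg ℂ CoxRing + Algebra.trdeg CoxRing K = Algebra.trdeg ℂ K :=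
    trdeg_add_eq ..
  rw [trdeg_eq_zero (R := CoxRing), add_zero] at h
  rw [h]
  simpa using hind.cardinalMk_le_trdeg

/-! ### Invariant sections as combinations of monomials -/

/-- The generators of `𝓡`, as one family. -/
noncomputable def gen : (Fin 5 × Fin 5) ⊕ Fin 5 → CoxRing :=
  Sum.elim (fun p => wGen p.1 p.2) uGen

/-- The weights of the generators of `𝓡`. -/
def genDeg : (Fin 5 × Fin 5) ⊕ Fin 5 → Lam :=
  Sum.elim (fun p => wDeg p.1 p.2) uDeg

theorem exists_incl_gen (x : (Fin 5 × Fin 5) ⊕ Fin 5) :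
    ∃ p : CV, incl (gen x) = AddMonoidAlgebra.single (genDeg x) p := by
  rcases x with ⟨i, j⟩ | k
  · exact ⟨_, incl_wGen i j⟩
  · exact ⟨_, incl_uGen k⟩

theorem exists_incl_prod_gen (s : (Fin 5 × Fin 5) ⊕ Fin 5 →₀ ℕ) :
    ∃ p : CV, incl (∏ x, gen x ^ s x) = AddMonoidAlgebra.single (∑ x, s x • genDeg x) p := by
  choose p hp using exists_incl_gen
  exact ⟨∏ x, p x ^ s x, by
    simp only [map_prod, map_pow, hp, AddMonoidAlgebra.single_pow, AddMonoidAlgebra.prod_single]⟩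

theorem exists_eq_sum_prod_gen (f : CoxRing) :
    ∃ P : MvPolynomial ((Fin 5 × Fin 5) ⊕ Fin 5) ℂ,
      f = ∑ s ∈ P.support, P.coeff s • ∏ x, gen x ^ s x := by
  have htop : (MvPolynomial.aeval (R := ℂ) gen).range = ⊤ :=
    eq_top_of_gen_mem _ (fun i j => ⟨MvPolynomial.X (Sum.inl (i, j)), by simp [gen]⟩)
      fun k => ⟨MvPolynomial.X (Sum.inr k), by simp [gen]⟩
  obtain ⟨P, hP⟩ : f ∈ (MvPolynomial.aeval (R := ℂ) gen).range := htop ▸ Algebra.mem_top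
  refine ⟨P, hP.symm.trans ?_⟩
  change MvPolynomial.aeval gen P = _
  rw [MvPolynomial.aeval_def, MvPolynomial.eval₂_eq']
  exact Finset.sum_congr rfl fun s _ => (Algebra.smul_def _ _).symm

theorem coeff_scale (τ : Torus) (F : Laurent) (d : Lam) :
    (scale τ F).coeff d = charVal d τ • F.coeff d := by
  induction F using AddMonoidAlgebra.induction_linear with
  | zero => simp
  | add F G hF hG => simp [hF, hG]
  | single e p =>
    rw [scale_single, AddMonoidAlgebra.coeff_single, AddMonoidAlgebra.coeff_single]
    by_cases h : e = d
    · subst h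
      simp
    · simp [Finsupp.single_eq_of_ne' h]

/-- The point of `𝕋_Λ` with `t_k = 2` and all other coordinates `1`. -/
noncomputable def twoAt (k : Fin 5) : Torus :=
  (zpowersHom ℂˣ (Units.mk0 2 two_ne_zero)).comp
    (AddMonoidHom.toMultiplicative ((Pi.evalAddMonoidHom (fun _ => ℤ) k).comp Lam.subtype))

theorem charVal_twoAt (d : Lam) (k : Fin 5) :
    charVal d (twoAt k) = (2 : ℂ) ^ ((d : Fin 5 → ℤ) k) := by
  change ((Units.mk0 (2 : ℂ) two_ne_zero ^ ((d : Fin 5 → ℤ) k) : ℂˣ) : ℂ) = _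
  simp

/-- The characters of `𝕋_Λ` separate the weights. -/
theorem eq_of_charVal_eq {d e : Lam} (h : ∀ τ, charVal d τ = charVal e τ) : d = e := by
  apply Subtype.ext
  funext k
  have hk := h (twoAt k)
  rw [charVal_twoAt, charVal_twoAt] at hk
  have h2 := congrArg norm hk
  rw [norm_zpow, norm_zpow, Complex.norm_ofNat] at h2
  exact zpow_right_injective₀ two_pos (by norm_num) h2

theorem charVal_nsmul (m : ℕ) (d : Lam) (τ : Torus) : charVal (m • d) τ = charVal d τ ^ m := by
  induction m with
  | zero => rw [zero_smul, charVal_zero, pow_zero]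
  | succ m ih => rw [succ_nsmul, charVal_add, ih, pow_succ]

theorem coeff_eq_zero_of_isInvariantSection {u : Lam} {m : ℕ} {f : CoxRing}
    (hf : IsInvariantSection u m f) {d : Lam} (hd : d ≠ m • u) : (incl f).coeff d = 0 := by
  by_contra hne
  refine hd (eq_of_charVal_eq fun τ => ?_)
  have h := congrArg (fun g => (incl g).coeff d) (hf τ)
  simp only [incl_act, coeff_scale, map_smul, AddMonoidAlgebra.coeff_smul,
    Finsupp.smul_apply] at h
  rw [charVal_nsmul]
  exact smul_left_injective ℂ hne h

/-- An invariant section which does not vanish at `z` contains a monomial of its own weight in the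
generators which does not vanish at `z`. -/
theorem exists_prod_gen_notMem {u : Lam} {m : ℕ} {f : CoxRing} (hf : IsInvariantSection u m f)
    {z : Ideal CoxRing} (hz : f ∉ z) :
    ∃ s : (Fin 5 × Fin 5) ⊕ Fin 5 →₀ ℕ, ∑ x, s x • genDeg x = m • u ∧ ∏ x, gen x ^ s x ∉ z := by
  by_contra! hcon
  obtain ⟨P, hP⟩ := exists_eq_sum_prod_gen f
  have hfil : f = ∑ s ∈ P.support with ∑ x, s x • genDeg x = m • u,
      P.coeff s • ∏ x, gen x ^ s x := by
    apply incl_injective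
    ext1
    ext1 d
    by_cases hd : d = m • u
    · conv_lhs => rw [hP]
      rw [map_sum, map_sum, AddMonoidAlgebra.coeff_sum, AddMonoidAlgebra.coeff_sum,
        Finsupp.finsetSum_apply, Finsupp.finsetSum_apply, Finset.sum_filter]
      refine Finset.sum_congr rfl fun s _ => ?_
      split_ifs with hs
      · rfl
      · obtain ⟨p, hp⟩ := exists_incl_prod_gen s
        rw [map_smul, hp, AddMonoidAlgebra.coeff_smul, AddMonoidAlgebra.coeff_single,
          Finsupp.smul_apply, Finsupp.single_eq_of_ne' (fun h => hs (h.trans hd)), smul_zero]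
    · rw [coeff_eq_zero_of_isInvariantSection hf hd, map_sum, AddMonoidAlgebra.coeff_sum,
        Finsupp.finsetSum_apply]
      refine (Finset.sum_eq_zero fun s hs => ?_).symm
      obtain ⟨p, hp⟩ := exists_incl_prod_gen s
      rw [map_smul, hp, AddMonoidAlgebra.coeff_smul, AddMonoidAlgebra.coeff_single,
        Finsupp.smul_apply, (Finset.mem_filter.1 hs).2,
        Finsupp.single_eq_of_ne' (fun h => hd h.symm), smul_zero]
  refine hz (hfil ▸ z.sum_mem fun s hs => ?_)
  rw [Algebra.smul_def]
  exact z.mul_mem_left _ (hcon s (Finset.mem_filter.1 hs).2)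

theorem sum_genDeg_apply (s : (Fin 5 × Fin 5) ⊕ Fin 5 →₀ ℕ) (i : Fin 5) :
    ((∑ x, s x • genDeg x : Lam) : Fin 5 → ℤ) i =
      ∑ j, ((s (Sum.inl (i, j)) : ℤ) + s (Sum.inl (j, i))) - 2 * s (Sum.inr i) := by
  have hw : ∀ p q : Fin 5, ((wDeg p q : Lam) : Fin 5 → ℤ) i =
      (if p = i then 1 else 0) + if q = i then 1 else 0 := fun p q => by
    change (Pi.single p (1 : ℤ) + Pi.single q 1 : Fin 5 → ℤ) i = _
    simp [Pi.single_apply, eq_comm]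
  have hu : ∀ k : Fin 5, ((uDeg k : Lam) : Fin 5 → ℤ) i = if k = i then -2 else 0 := fun k => by
    change (Pi.single k (-2) : Fin 5 → ℤ) i = _
    simp [Pi.single_apply, eq_comm]
  rw [AddSubgroup.val_finsetSum, Finset.sum_apply]
  simp only [AddSubgroup.coe_nsmul, Pi.smul_apply, Fintype.sum_sum_type, Fintype.sum_prod_type,
    genDeg, Sum.elim_inl, Sum.elim_inr, hw, hu, nsmul_eq_mul, mul_add, Finset.sum_add_distrib,
    mul_ite, mul_one, mul_zero, Finset.sum_ite_eq', Finset.mem_univ, if_true]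
  rw [Finset.sum_comm]
  simp only [Finset.sum_ite_eq', Finset.mem_univ, if_true]
  ring

/-- `𝓡` is regular at the semistable points, those where an invariant section does not vanish. -/
theorem isRegularLocalRing_of_isInvariantSection {m : ℕ} (hm : 0 < m) {f : CoxRing}
    (hf : IsInvariantSection kappa m f) (z : Ideal CoxRing) [z.IsPrime] (hfz : f ∉ z) :
    IsRegularLocalRing (Localization.AtPrime z) := by
  obtain ⟨s, hs, hsz⟩ := exists_prod_gen_notMem hf hfz
  have hgen : ∀ x, s x ≠ 0 → gen x ∉ z := fun x hx hmem =>
    hsz (z.mem_of_dvd (Finset.dvd_prod_of_mem _ (Finset.mem_univ x))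
      (z.pow_mem_of_mem hmem _ (Nat.pos_of_ne_zero hx)))
  obtain ⟨a, b, c, hbc, hab, hac, h⟩ := isIsotropicPlane.exists_transversal z
    (fun i j => s (Sum.inl (i, j)) + s (Sum.inl (j, i))) (fun k => s (Sum.inr k)) hm
    (fun i j => add_comm _ _)
    (fun i => by
      have h := sum_genDeg_apply s i
      rw [hs] at h
      have hk : ((m • kappa : Lam) : Fin 5 → ℤ) i = m * 2 := by
        rw [AddSubgroup.coe_nsmul, Pi.smul_apply, nsmul_eq_mul]
        rfl
      rw [hk] at h
      zify
      linarith)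
    (fun i j hij => by
      by_cases h0 : s (Sum.inl (i, j)) = 0
      · exact isIsotropicPlane.swap_notMem (hgen (Sum.inl (j, i)) (by omega))
      · exact hgen (Sum.inl (i, j)) h0)
    (fun k => hgen (Sum.inr k))
  exact isIsotropicPlane.isRegularLocalRing eq_top_of_gen_mem nine_le_trdeg z hbc hab hac h

end OrderThirtyTwo

theorem mainTheorem8 (z : OrderThirtyTwo.SpecR)
    (hz : z ∈ OrderThirtyTwo.stableLocus OrderThirtyTwo.kappa) :
    IsRegularLocalRing (Localization.AtPrime z.asIdeal) := by
  obtain ⟨-, m, hm, f, hf, hfz, -⟩ := hz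
  exact OrderThirtyTwo.isRegularLocalRing_of_isInvariantSection hm hf z.asIdeal hfz
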